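/- Let $G$ be a finite simple graph embedded in a closed connected surface $\Sigma$ (for example, by a 2-cell triangulation embedding of $G$ in a surface other than the sphere). Call a closed walk of $G$, and in particular a cycle, noncontractible if the closed curve that it traces is not null-homotopic in $\Sigma$. Lengths are numbers of edges. The width $w$ of the embedding is the length of a shortest noncontractible cycle of $G$. For a cycle $C$ of $G$, let $\mathrm{ncdist}(C)$ be the least length of a path (or cycle) $P$ of $G$ that begins at a vertex $x$ of $C$ and ends at a vertex $y$ of $C$ such that - if $x \neq y$, then $P$ is a path, and $P$ forms a noncontractible closed walk with each of the two arcs of $C$ between $x$ and $y$ (these closed walks are cycles when $P$ meets $C$ only in $x$ and $y$; the interior of $P$ is allowed to meet $C$); - if $x = y$, then $P$ is a noncontractible cycle through $x$. If there is no such $P$, put $\mathrm{ncdist}(C) = \infty$. If $C$ is a shortest noncontractible cycle of $G$, then $\mathrm{ncdist}(C) \geq w/2$. -/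

import Mathlib

open scoped ENNReal

/-- An embedding of a simple graph `G` in a topological space `S`: the vertices are distinct points
of `S`, every edge is a simple arc of `S` joining its two ends (the two orientations of an edge are
traversals of the same arc in opposite directions), and an interior point of an arc is neither a
vertex nor a point of another arc. -/
structure GraphEmbedding {V : Type*} (G : SimpleGraph V) (S : Type*) [TopologicalSpace S] where
  /-- the point of `S` that represents a vertex -/
  vertex : V → S
  /-- the arc of `S` that represents an edge, traversed from `u` to `v` -/
  edge : ∀ {u v : V}, G.Adj u v → Path (vertex u) (vertex v)
  vertex_injective : Function.Injective vertex
  edge_injective : ∀ {u v : V} (h : G.Adj u v), Function.Injective (edge h)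
  edge_symm : ∀ {u v : V} (h : G.Adj u v), edge h.symm = (edge h).symm
  edge_ne_vertex : ∀ {u v : V} (h : G.Adj u v) (t : unitInterval), t ≠ 0 → t ≠ 1 →
    ∀ w : V, edge h t ≠ vertex w
  edge_disjoint : ∀ {u v u' v' : V} (h : G.Adj u v) (h' : G.Adj u' v'), s(u, v) ≠ s(u', v') →
    ∀ t t' : unitInterval, t ≠ 0 → t ≠ 1 → edge h t ≠ edge h' t'

namespace GraphEmbedding

variable {V : Type*} {G : SimpleGraph V} {S : Type*} [TopologicalSpace S]

/-- The curve in `S` that is traced by a walk of the embedded graph. -/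
noncomputable def curve (E : GraphEmbedding G S) :
    ∀ {u v : V}, G.Walk u v → Path (E.vertex u) (E.vertex v)
  | _, _, .nil => Path.refl _
  | _, _, .cons h p => (E.edge h).trans (E.curve p)

/-- A closed walk (in particular, a cycle) is noncontractible if the closed curve that it traces is
not null-homotopic in `S`. -/
def Noncontractible (E : GraphEmbedding G S) {v : V} (c : G.Walk v v) : Prop :=
  ¬ (E.curve c).Homotopic (Path.refl (E.vertex v))

/-- The lengths of the noncontractible cycles. -/
def noncontractibleCycleLengths (E : GraphEmbedding G S) : Set ℕ :=
  {n | ∃ (v : V) (c : G.Walk v v), c.IsCycle ∧ E.Noncontractible c ∧ c.length = n}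

/-- The width of the embedding: the length of a shortest noncontractible cycle
(`⊤` if there is no noncontractible cycle). -/
noncomputable def width (E : GraphEmbedding G S) : ℕ∞ :=
  ⨅ n ∈ E.noncontractibleCycleLengths, (n : ℕ∞)

/-- `C` is a shortest noncontractible cycle. -/
def IsShortestNoncontractibleCycle (E : GraphEmbedding G S) {v : V} (C : G.Walk v v) : Prop :=
  C.IsCycle ∧ E.Noncontractible C ∧
    ∀ (u : V) (D : G.Walk u u), D.IsCycle → E.Noncontractible D → C.length ≤ D.length

open Classical in
/-- `A` and `B` are the two arcs into which `x` and `y` divide the cycle `C`: started at `x`,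
the cycle runs along `A` from `x` to `y` and then along `B` from `y` back to `x`. -/
def Arcs {v x y : V} (C : G.Walk v v) (A : G.Walk x y) (B : G.Walk y x) : Prop :=
  ∃ hx : x ∈ C.support, C.rotate x hx = A.append B

/-- The lengths of the paths `P` that count for `ncdist`: either `P` is a noncontractible cycle
through a vertex `x` of `C`, or `P` is a path between distinct vertices `x`, `y` of `C` which forms
a noncontractible closed walk with each of the two arcs of `C` between `x` and `y`. -/
def ncLengths (E : GraphEmbedding G S) {v : V} (C : G.Walk v v) : Set ℕ :=
  {n | (∃ x ∈ C.support, ∃ P : G.Walk x x,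
          P.IsCycle ∧ E.Noncontractible P ∧ P.length = n) ∨
       (∃ (x y : V) (A : G.Walk x y) (B : G.Walk y x) (P : G.Walk x y),
          x ≠ y ∧ Arcs C A B ∧ P.IsPath ∧
          E.Noncontractible (P.append B) ∧ E.Noncontractible (P.append A.reverse) ∧
          P.length = n)}

/-- The length of a shortest path that counts for `ncdist` (`⊤` if there is none). -/
noncomputable def ncdist (E : GraphEmbedding G S) {v : V} (C : G.Walk v v) : ℕ∞ :=
  ⨅ n ∈ E.ncLengths C, (n : ℕ∞)

end GraphEmbedding

/-!
A closed walk that is not a cycle can be shortened by cutting off a cycle or a backtracked edge, and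
if what is cut off is contractible then the homotopy class of the walk does not change. Hence every
noncontractible closed walk, cycle or not, has at least `w` edges. If `x` and `y` divide `C` into
the arcs `A` and `B`, and `P` forms a noncontractible closed walk with each of them, then
`w ≤ |P| + |A|` and `w ≤ |P| + |B|`, so that `2w ≤ 2|P| + |C|`; and `|C| ≤ w` leaves `w ≤ 2|P|`.
-/

namespace GraphEmbedding

open SimpleGraph Walk

variable {V : Type*} {G : SimpleGraph V} {S : Type*} [TopologicalSpace S] (E : GraphEmbedding G S)

/-- The class, up to homotopy with fixed ends, of the curve traced by a walk. Working in the
quotient makes concatenation associative and cancels backtracked edges. -/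
noncomputable def homotopyClass {u v : V} (p : G.Walk u v) :
    Path.Homotopic.Quotient (E.vertex u) (E.vertex v) :=
  .mk (E.curve p)

theorem noncontractible_iff_homotopyClass_ne_refl {v : V} {c : G.Walk v v} :
    E.Noncontractible c ↔ E.homotopyClass c ≠ .refl (E.vertex v) :=
  Path.Homotopic.Quotient.eq.symm.not

theorem homotopyClass_nil (v : V) : E.homotopyClass (nil : G.Walk v v) = .refl (E.vertex v) :=
  rfl

theorem homotopyClass_cons {u v w : V} (h : G.Adj u v) (p : G.Walk v w) :
    E.homotopyClass (cons h p) = .trans (.mk (E.edge h)) (E.homotopyClass p) :=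
  rfl

theorem homotopyClass_append {u v w : V} (p : G.Walk u v) (q : G.Walk v w) :
    E.homotopyClass (p.append q) = .trans (E.homotopyClass p) (E.homotopyClass q) := by
  induction p with
  | nil => exact (Path.Homotopic.Quotient.refl_trans _).symm
  | cons h p ih =>
    rw [cons_append, homotopyClass_cons, homotopyClass_cons, ih,
      Path.Homotopic.Quotient.trans_assoc]

theorem homotopyClass_cons_symm_toWalk {u v : V} (h : G.Adj u v) :
    E.homotopyClass (cons h h.symm.toWalk) = .refl (E.vertex u) := by
  rw [homotopyClass_cons, Adj.toWalk, homotopyClass_cons, homotopyClass_nil, E.edge_symm h,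
    Path.Homotopic.Quotient.trans_refl, Path.Homotopic.Quotient.mk_symm,
    Path.Homotopic.Quotient.trans_symm]

variable {E}

theorem homotopyClass_eq_refl_of_isCycle {v : V} {c : G.Walk v v} (hc : c.IsCycle)
    (hlt : (c.length : ℕ∞) < E.width) : E.homotopyClass c = .refl (E.vertex v) := by
  by_contra hne
  have hnon : E.Noncontractible c := E.noncontractible_iff_homotopyClass_ne_refl.mpr hne
  exact hlt.not_ge (iInf₂_le c.length ⟨v, c, hc, hnon, rfl⟩)

theorem homotopyClass_cons_eq_refl_of_isPath {u v : V} (h : G.Adj u v) {p : G.Walk v u}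
    (hp : p.IsPath) (hlt : ((cons h p).length : ℕ∞) < E.width) :
    E.homotopyClass (cons h p) = .refl (E.vertex u) := by
  by_cases hmem : s(u, v) ∈ p.edges
  · rw [hp.eq_adj_toWalk_of_mem_edges (Sym2.eq_swap ▸ hmem)]
    exact E.homotopyClass_cons_symm_toWalk h
  · exact homotopyClass_eq_refl_of_isCycle ((cons_isCycle_iff p h).mpr ⟨hp, hmem⟩) hlt

theorem homotopyClass_bypass [DecidableEq V] {u v : V} {p : G.Walk u v}
    (hlt : (p.length : ℕ∞) < E.width) : E.homotopyClass p.bypass = E.homotopyClass p := by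
  induction p with
  | nil => rfl
  | @cons u _ _ h p ih =>
    have hp : E.homotopyClass p.bypass = E.homotopyClass p :=
      ih (lt_of_le_of_lt (by simp) hlt)
    rw [homotopyClass_cons, ← hp]
    by_cases hu : u ∈ p.bypass.support
    · have hloop : E.homotopyClass (cons h (p.bypass.takeUntil u hu)) = .refl (E.vertex u) := by
        refine homotopyClass_cons_eq_refl_of_isPath h (p.bypass_isPath.takeUntil hu)
          (lt_of_le_of_lt ?_ hlt)
        simpa using (p.bypass.length_takeUntil_le_length hu).trans p.length_bypass_le_length
      calc E.homotopyClass (cons h p).bypass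
        _ = E.homotopyClass (p.bypass.dropUntil u hu) := by simp only [bypass, hu, dite_true]
        _ = E.homotopyClass ((cons h (p.bypass.takeUntil u hu)).append
              (p.bypass.dropUntil u hu)) := by
          rw [homotopyClass_append, hloop, Path.Homotopic.Quotient.refl_trans]
        _ = .trans (.mk (E.edge h)) (E.homotopyClass p.bypass) := by
          rw [cons_append, take_spec, homotopyClass_cons]
    · simp only [bypass, hu, dite_false, homotopyClass_cons]

theorem Noncontractible.width_le_length {v : V} {c : G.Walk v v} (hc : E.Noncontractible c) :
    E.width ≤ c.length := by
  classical
  by_contra! hlt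
  have hnil : c.bypass = nil := eq_nil_iff_nil.mpr (isPath_iff_nil.mp c.bypass_isPath)
  refine E.noncontractible_iff_homotopyClass_ne_refl.mp hc ?_
  rw [← homotopyClass_bypass hlt, hnil, homotopyClass_nil]

theorem Arcs.length_add_length {v x y : V} {C : G.Walk v v} {A : G.Walk x y} {B : G.Walk y x}
    (h : Arcs C A B) : A.length + B.length = C.length := by
  classical
  obtain ⟨hx, hrotate⟩ := h
  rw [← length_append, ← hrotate, length_rotate]

theorem two_mul_width_le_of_mem_ncLengths {v : V} {C : G.Walk v v} {n : ℕ}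
    (hn : n ∈ E.ncLengths C) : 2 * E.width ≤ 2 * n + C.length := by
  rcases hn with ⟨x, -, P, -, hP, rfl⟩ | ⟨x, y, A, B, P, -, hAB, -, hPB, hPA, rfl⟩
  · calc 2 * E.width
      _ ≤ 2 * P.length := by gcongr; exact hP.width_le_length
      _ ≤ 2 * P.length + C.length := le_self_add
  · calc 2 * E.width
      _ = E.width + E.width := two_mul _
      _ ≤ (P.append B).length + (P.append A.reverse).length :=
        add_le_add hPB.width_le_length hPA.width_le_length
      _ = 2 * P.length + C.length := by
        rw [length_append, length_append, length_reverse, ← hAB.length_add_length]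
        push_cast
        ring

variable (E) in
theorem two_mul_width_le_two_mul_ncdist_add_length {v : V} (C : G.Walk v v) :
    2 * E.width ≤ 2 * E.ncdist C + C.length := by
  simp only [ncdist, ENat.mul_iInf_of_ne two_ne_zero, ENat.iInf_add]
  exact le_iInf₂ fun n hn => two_mul_width_le_of_mem_ncLengths hn

theorem IsShortestNoncontractibleCycle.length_le_width {v : V} {C : G.Walk v v}
    (hC : E.IsShortestNoncontractibleCycle C) : C.length ≤ E.width := by
  refine le_iInf₂ ?_
  rintro _ ⟨u, D, hD, hnon, rfl⟩
  exact_mod_cast hC.2.2 u D hD hnon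

end GraphEmbedding

theorem proposition1_general {V : Type*} {G : SimpleGraph V} {S : Type*} [TopologicalSpace S]
    (E : GraphEmbedding G S) {v : V} (C : G.Walk v v) (hC : C.length ≤ E.width) :
    (E.width : ℝ≥0∞) / 2 ≤ (E.ncdist C : ℝ≥0∞) := by
  have hadd : E.width + C.length ≤ 2 * E.ncdist C + C.length :=
    calc E.width + C.length
      _ ≤ E.width + E.width := by gcongr
      _ = 2 * E.width := (two_mul _).symm
      _ ≤ 2 * E.ncdist C + C.length := E.two_mul_width_le_two_mul_ncdist_add_length C
  have hwidth : E.width ≤ 2 * E.ncdist C :=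
    (ENat.add_le_add_iff_right (ENat.natCast_ne_top C.length)).mp hadd
  refine ENNReal.div_le_of_le_mul' ?_
  exact_mod_cast ENat.toENNReal_le.mpr hwidth

theorem proposition1 {V : Type*} [Finite V] (G : SimpleGraph V)
    {S : Type*} [TopologicalSpace S] [T2Space S] [CompactSpace S] [ConnectedSpace S]
    [ChartedSpace (EuclideanSpace ℝ (Fin 2)) S]
    (E : GraphEmbedding G S) {v : V} (C : G.Walk v v)
    (hC : E.IsShortestNoncontractibleCycle C) :
    (E.width : ℝ≥0∞) / 2 ≤ (E.ncdist C : ℝ≥0∞) :=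
  proposition1_general E C hC.length_le_width
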